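/- Let $W$ be a finite reflection group acting on $\mathbb R^n$, i.e. a finite group of linear isometries generated by orthogonal reflections in hyperplanes through the origin. Let $P\subset\mathbb R^n$ be a Platonic polytope for $W$: $P$ is the convex hull of the $W$-orbit of a single point, $P$ is $n$-dimensional, and for every $0\le d\le n-1$ all $d$-dimensional faces of $P$ belong to one orbit of $W$. For a face $f$ of $P$ let $G_s(f)=\{w\in W : wx=x \text{ for all } x\in f\}$ be its pointwise stabilizer. Let $1\le d\le n-2$ (so $n\ge 3$), let $f_{d-1}$ be a $(d-1)$-dimensional face of $P$ and let $f_d$ be a $d$-dimensional face of $P$. Then the number of $d$-dimensional faces of $P$ that contain $f_{d-1}$ equals $$\#f_d(f_{d-1})=\frac{|G_s(f_{d-1})|}{|G_s(f_d)|}.$$ -/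

import Mathlib

/-- A finite reflection group (finite Coxeter group in its geometric realisation) acting on `ℝⁿ`:
a finite group of linear isometries generated by the orthogonal reflections in hyperplanes through
the origin that it contains. -/
structure IsFiniteReflectionGroup {n : ℕ}
    (W : Subgroup (EuclideanSpace ℝ (Fin n) ≃ₗᵢ[ℝ] EuclideanSpace ℝ (Fin n))) : Prop where
  finite : Finite W
  generated : W = Subgroup.closure
    {s | s ∈ W ∧ ∃ v : EuclideanSpace ℝ (Fin n), v ≠ 0 ∧ s = (Submodule.span ℝ {v})ᗮ.reflection}

/-- `F` is a `d`-dimensional face of the convex set `P`: a nonempty set of all maximisers on `P` of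
some linear functional, whose affine span has dimension `d`. -/
def IsFaceOfDim {n : ℕ} (P : Set (EuclideanSpace ℝ (Fin n))) (d : ℕ)
    (F : Set (EuclideanSpace ℝ (Fin n))) : Prop :=
  IsExposed ℝ P F ∧ F.Nonempty ∧ Module.finrank ℝ (vectorSpan ℝ F) = d

/-- `P ⊆ ℝⁿ` is a Platonic polytope for the finite reflection group `W`: it is the convex hull of
the `W`-orbit of one seed point, it is `n`-dimensional, and for every `0 ≤ d ≤ n - 1` its
`d`-dimensional faces belong to one orbit of `W`. -/
structure IsPlatonicPolytope {n : ℕ}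
    (W : Subgroup (EuclideanSpace ℝ (Fin n) ≃ₗᵢ[ℝ] EuclideanSpace ℝ (Fin n)))
    (P : Set (EuclideanSpace ℝ (Fin n))) : Prop where
  group : IsFiniteReflectionGroup W
  seed : ∃ x : EuclideanSpace ℝ (Fin n), P = convexHull ℝ {y | ∃ w ∈ W, w x = y}
  full_dim : affineSpan ℝ P = ⊤
  one_orbit : ∀ d : ℕ, d < n → ∀ F F' : Set (EuclideanSpace ℝ (Fin n)),
    IsFaceOfDim P d F → IsFaceOfDim P d F' → ∃ w ∈ W, w '' F = F'

/-- The group `G_s(F)`: the elements of `W` that fix every point of `F`. -/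
def pointwiseStabilizer {n : ℕ}
    (W : Subgroup (EuclideanSpace ℝ (Fin n) ≃ₗᵢ[ℝ] EuclideanSpace ℝ (Fin n)))
    (F : Set (EuclideanSpace ℝ (Fin n))) :
    Subgroup (EuclideanSpace ℝ (Fin n) ≃ₗᵢ[ℝ] EuclideanSpace ℝ (Fin n)) where
  carrier := {w | w ∈ W ∧ ∀ x ∈ F, w x = x}
  mul_mem' := by
    rintro a b ⟨ha, ha'⟩ ⟨hb, hb'⟩
    refine ⟨W.mul_mem ha hb, fun x hx => ?_⟩
    exact (congrArg a (hb' x hx)).trans (ha' x hx)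
  one_mem' := ⟨W.one_mem, fun _ _ => rfl⟩
  inv_mem' := by
    rintro a ⟨ha, ha'⟩
    refine ⟨W.inv_mem ha, fun x hx => ?_⟩
    exact (LinearIsometryEquiv.symm_apply_eq a).2 (ha' x hx).symm

/-! Let `H` be the pointwise stabilizer of the (d-1)-face `f`. It acts on the d-faces containing
`f`, and the claim is orbit-stabilizer for this action. One such face `G` exists by
`exists_face_succ`. An element of `H` preserving `G` also fixes the mean of the vertices of `G`, a
point outside `f`; as `f` has codimension 1 in `G`, it fixes `G` pointwise (`fixes_of_fixes_facet`).
So the stabilizer of `G` in `H` is the pointwise stabilizer of `G`, which is conjugate to that of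
any other d-face.

Transitivity of `H` (`exists_fixing_image_eq`) is where reflections enter. If `G` and `G'` contain
`f` and lie in one `W`-orbit but have different vertex means, some mirror strictly separates the
means (`exists_root_separating`). Each face lies weakly on the side of its mean
(`IsFace.inner_nonneg`), so `f` lies in the mirror and the reflection belongs to `H`. It brings the
means closer, so an element of `H` bringing them closest makes them equal, and a face is determined
by its mean.

The separating mirror comes from freeness of the action on chambers (`eq_one_of_forall_nonneg`),
proved by the exchange condition. -/

namespace FiniteReflection

open scoped InnerProductSpace

variable {E : Type*} [NormedAddCommGroup E] [InnerProductSpace ℝ E]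

/-! ### Reflections and roots -/

/-- The orthogonal reflection in the hyperplane orthogonal to `α`. -/
noncomputable def refl (α : E) : E ≃ₗᵢ[ℝ] E := (Submodule.span ℝ {α})ᗮ.reflection

theorem refl_apply {α : E} (hα : ‖α‖ = 1) (x : E) : refl α x = x - (2 * ⟪α, x⟫_ℝ) • α := by
  rw [refl, Submodule.reflection_orthogonal_apply, Submodule.reflection_singleton_apply, hα]
  simp only [RCLike.ofReal_real_eq_id, id_eq, one_pow, div_one]
  module

theorem refl_self {α : E} : refl α α = -α := by
  simp [refl, Submodule.reflection_orthogonalComplement_singleton_eq_neg]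

theorem refl_refl (α x : E) : refl α (refl α x) = x := by
  simp [refl]

theorem refl_mul_self (α : E) : refl α * refl α = 1 := by
  ext x; exact refl_refl α x

theorem inner_refl_right {α : E} (x y : E) : ⟪x, refl α y⟫_ℝ = ⟪refl α x, y⟫_ℝ := by
  rw [← LinearIsometryEquiv.inner_map_map (refl α) x, refl_refl]

theorem refl_map {α : E} (hα : ‖α‖ = 1) (w : E ≃ₗᵢ[ℝ] E) :
    refl (w α) = w * refl α * w⁻¹ := by
  ext x
  have h : ‖w α‖ = 1 := by simpa using hα
  obtain ⟨y, rfl⟩ := w.surjective x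
  have h2 : (w * refl α * w⁻¹) (w y) = w (refl α y) := by
    change w (refl α (w.symm (w y))) = _
    simp
  rw [h2, refl_apply h, refl_apply hα]
  simp

theorem refl_smul {k : ℝ} (hk : k ≠ 0) (α : E) : refl (k • α) = refl α := by
  unfold refl
  congr 2
  exact Submodule.span_singleton_smul_eq (IsUnit.mk0 k hk) α

theorem refl_neg (α : E) : refl (-α) = refl α := by
  simpa using refl_smul (k := -1) (by norm_num) α

/-- The unit normals of the reflecting hyperplanes of `W`. -/
def roots (W : Subgroup (E ≃ₗᵢ[ℝ] E)) : Set E := {α | ‖α‖ = 1 ∧ refl α ∈ W}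

variable {W : Subgroup (E ≃ₗᵢ[ℝ] E)}

theorem map_mem_roots {w : E ≃ₗᵢ[ℝ] E} (hw : w ∈ W) {α : E} (hα : α ∈ roots W) :
    w α ∈ roots W := by
  refine ⟨by simpa using hα.1, ?_⟩
  rw [refl_map hα.1]
  exact W.mul_mem (W.mul_mem hw hα.2) (W.inv_mem hw)

theorem neg_mem_roots {α : E} (hα : α ∈ roots W) : -α ∈ roots W :=
  ⟨by simpa using hα.1, by rw [refl_neg]; exact hα.2⟩

/-- A reflection determines its unit normal up to sign, so each element of `W` accounts for at most
two roots. -/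
theorem roots_finite [Finite W] : (roots W).Finite := by
  have hW : (W : Set (E ≃ₗᵢ[ℝ] E)).Finite := Set.toFinite _
  refine Set.Finite.subset (hW.biUnion (t := fun t => {α : E | ‖α‖ = 1 ∧ refl α = t}) ?_)
    (fun α hα => Set.mem_biUnion hα.2 ⟨hα.1, rfl⟩)
  intro t _
  by_cases h : ∃ α : E, ‖α‖ = 1 ∧ refl α = t
  · obtain ⟨α, hα, rfl⟩ := h
    refine Set.Finite.subset (Set.toFinite {α, -α}) ?_
    rintro β ⟨hβ, hβα⟩
    have h1 : -β = β - (2 * ⟪α, β⟫_ℝ) • α := by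
      rw [← refl_apply hα, ← hβα, refl_self]
    have h2 : β = ⟪α, β⟫_ℝ • α := by
      have : (2 : ℝ) • β = (2 : ℝ) • ⟪α, β⟫_ℝ • α := by
        rw [two_smul, smul_smul]; nth_rewrite 1 [← neg_neg β]; rw [h1]; abel
      exact smul_right_injective E (by norm_num : (2 : ℝ) ≠ 0) this
    have h3 : |⟪α, β⟫_ℝ| = 1 := by
      have := congrArg norm h2
      rw [norm_smul, hα, hβ] at this
      simpa using this.symm
    rcases eq_or_eq_neg_of_abs_eq h3 with h4 | h4 <;> rw [h4] at h2
    · left; simpa using h2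
    · right; simpa using h2
  · refine Set.Finite.subset Set.finite_empty ?_
    rintro β hβ
    exact h ⟨β, hβ⟩

/-! ### Simple roots, exchange and freeness on chambers -/

/-- The roots on the positive side with respect to `c`. -/
def posRoots (W : Subgroup (E ≃ₗᵢ[ℝ] E)) (c : E) : Set E := {α ∈ roots W | 0 < ⟪α, c⟫_ℝ}

/-- The positive roots `α` whose hyperplane is the only one separating `c` from its mirror image. -/
def simpleRoots (W : Subgroup (E ≃ₗᵢ[ℝ] E)) (c : E) : Set E :=
  {α ∈ posRoots W c | ∀ β ∈ posRoots W c, ⟪β, refl α c⟫_ℝ < 0 → β = α}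

variable {c : E}

/-- If `β ≠ α` is another positive root made negative by the reflection in `α`, take `γ = -refl α β`
and `k = 2⟪α, β⟫`. The bound `k < 2` is strict Cauchy–Schwarz; it forces one of `β`, `γ` to have
smaller height `⟪·, c⟫` than `α`. -/
theorem exists_add_eq_smul {α : E} (hα : α ∈ posRoots W c)
    (hs : α ∉ simpleRoots W c) :
    ∃ β ∈ posRoots W c, ∃ γ ∈ posRoots W c, ∃ k : ℝ, 0 < k ∧ k < 2 ∧ β + γ = k • α := by
  have : ∃ β ∈ posRoots W c, ⟪β, refl α c⟫_ℝ < 0 ∧ β ≠ α := by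
    by_contra! h
    exact hs ⟨hα, fun β hβ h' => h β hβ h'⟩
  obtain ⟨β, hβ, h1, h2⟩ := this
  have h3 : refl α β = β - (2 * ⟪α, β⟫_ℝ) • α := refl_apply hα.1.1 β
  have h4 : ⟪refl α β, c⟫_ℝ < 0 := by rwa [← inner_refl_right]
  refine ⟨β, hβ, -refl α β, ⟨neg_mem_roots (map_mem_roots hα.1.2 hβ.1), ?_⟩,
    2 * ⟪α, β⟫_ℝ, ?_, ?_, ?_⟩
  · rw [inner_neg_left]; linarith
  · rw [h3, inner_sub_left, inner_smul_left] at h4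
    simp only [conj_trivial] at h4
    have := hβ.2
    have h5 : 0 < (2 * ⟪α, β⟫_ℝ) * ⟪α, c⟫_ℝ := by linarith
    exact pos_of_mul_pos_left h5 hα.2.le
  · have := (inner_lt_one_iff_real_of_norm_eq_one hα.1.1 hβ.1.1).2 (Ne.symm h2)
    linarith
  · rw [h3]; module

/-- Move `q` towards `c` until it last meets a mirror, at `q + M • c`. Among the positive roots
vanishing there, one of least height is simple: otherwise it splits into two positive roots that
also vanish there, one of them lower. -/
theorem exists_simpleRoot_neg [Finite W] {q : E}
    (h : ∃ α ∈ posRoots W c, ⟪α, q⟫_ℝ < 0) : ∃ s ∈ simpleRoots W c, ⟪s, q⟫_ℝ < 0 := by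
  have hfin : (posRoots W c).Finite := roots_finite.subset (fun α hα => hα.1)
  obtain ⟨α₁, hα₁, hq₁⟩ := h
  obtain ⟨α₀, hα₀, hmax⟩ := Set.exists_max_image (posRoots W c)
    (fun α => -⟪α, q⟫_ℝ / ⟪α, c⟫_ℝ) hfin ⟨α₁, hα₁⟩
  set M := -⟪α₀, q⟫_ℝ / ⟪α₀, c⟫_ℝ with hM
  have hMpos : 0 < M := lt_of_lt_of_le (div_pos (by linarith) hα₁.2) (hmax α₁ hα₁)
  have hp : ∀ β ∈ posRoots W c, 0 ≤ ⟪β, q⟫_ℝ + M * ⟪β, c⟫_ℝ := by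
    intro β hβ
    have := hmax β hβ
    rw [div_le_iff₀ hβ.2] at this
    linarith
  have hp₀ : ⟪α₀, q⟫_ℝ + M * ⟪α₀, c⟫_ℝ = 0 := by
    rw [hM, div_mul_cancel₀ _ hα₀.2.ne']; ring
  obtain ⟨s, ⟨hs, hs0⟩, hmin⟩ := Set.exists_min_image
    {α ∈ posRoots W c | ⟪α, q⟫_ℝ + M * ⟪α, c⟫_ℝ = 0} (fun α => ⟪α, c⟫_ℝ)
    (hfin.subset fun α hα => hα.1) ⟨α₀, hα₀, hp₀⟩
  have hsc := hs.2
  refine ⟨s, ?_, by nlinarith⟩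
  by_contra hns
  obtain ⟨β, hβ, γ, hγ, k, hk0, hk2, hk⟩ := exists_add_eq_smul hs hns
  have e : ∀ x, ⟪β, x⟫_ℝ + ⟪γ, x⟫_ℝ = k * ⟪s, x⟫_ℝ := fun x => by
    rw [← inner_add_left, hk, inner_smul_left]; simp
  have h1 := hp β hβ
  have h2 := hp γ hγ
  have h3 : (⟪β, q⟫_ℝ + M * ⟪β, c⟫_ℝ) + (⟪γ, q⟫_ℝ + M * ⟪γ, c⟫_ℝ) = 0 := by
    linear_combination e q + M * e c + k * hs0
  have h4 := hmin β ⟨hβ, by linarith⟩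
  have h5 := hmin γ ⟨hγ, by linarith⟩
  have h6 := e c
  nlinarith

/-- Descent on height: a lowest counterexample `β` has positive inner product with some simple `s`,
so `refl s β` is lower and its reflection is conjugate to that of `β`. -/
theorem refl_mem_closure_simpleRoots [Finite W] (hc : ∀ α ∈ roots W, ⟪α, c⟫_ℝ ≠ 0) {α : E}
    (hα : α ∈ posRoots W c) : refl α ∈ Subgroup.closure (refl '' simpleRoots W c) := by
  have hfin : (posRoots W c).Finite := roots_finite.subset (fun α hα => hα.1)
  by_contra hbad
  obtain ⟨β, ⟨hβ, hβbad⟩, hmin⟩ := Set.exists_min_image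
    {α ∈ posRoots W c | refl α ∉ Subgroup.closure (refl '' simpleRoots W c)}
    (fun α => ⟪α, c⟫_ℝ) (hfin.subset fun α hα => hα.1) ⟨α, hα, hbad⟩
  obtain ⟨s, hs, hsβ⟩ := exists_simpleRoot_neg (q := -β)
    ⟨β, hβ, by rw [inner_neg_right, real_inner_self_eq_norm_sq, hβ.1.1]; norm_num⟩
  have hsmem : refl s ∈ Subgroup.closure (refl '' simpleRoots W c) :=
    Subgroup.subset_closure ⟨s, hs, rfl⟩
  have hne : β ≠ s := by rintro rfl; exact hβbad hsmem
  rw [inner_neg_right] at hsβ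
  have hroot := map_mem_roots hs.1.1.2 hβ.1
  -- The reflection in a simple root `s` makes no positive root other than `s` negative.
  have hpos : 0 < ⟪refl s β, c⟫_ℝ := by
    rcases lt_or_gt_of_ne (hc _ hroot) with h | h
    · exact absurd (hs.2 β hβ (by rwa [inner_refl_right])) hne
    · exact h
  have hlt : ⟪refl s β, c⟫_ℝ < ⟪β, c⟫_ℝ := by
    rw [refl_apply hs.1.1.1, inner_sub_left, inner_smul_left]
    simp only [conj_trivial]
    have := mul_pos (show 0 < 2 * ⟪s, β⟫_ℝ by linarith) hs.1.2
    linarith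
  have hin : refl (refl s β) ∈ Subgroup.closure (refl '' simpleRoots W c) := by
    by_contra h
    exact absurd (hmin _ ⟨⟨hroot, hpos⟩, h⟩) (not_le.2 hlt)
  apply hβbad
  rw [← refl_refl s β, refl_map (by simpa using hβ.1.1)]
  exact mul_mem (mul_mem hsmem hin) (inv_mem hsmem)

/-- The gallery from `c` spelled by the word must cross the mirror of `β`; deleting the letter at a
crossing multiplies the product by `refl β`. -/
theorem exchange (hc : ∀ α ∈ roots W, ⟪α, c⟫_ℝ ≠ 0) (L : List E) (hL : ∀ s ∈ L, s ∈ simpleRoots W c)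
    {β : E} (hβ : β ∈ posRoots W c) (hneg : ⟪β, (L.map refl).prod c⟫_ℝ < 0) :
    ∃ L' : List E, (∀ s ∈ L', s ∈ simpleRoots W c) ∧ L'.length + 1 = L.length ∧
      (L'.map refl).prod = refl β * (L.map refl).prod := by
  induction L generalizing β with
  | nil =>
    have : ⟪β, c⟫_ℝ < 0 := by simpa using hneg
    exact absurd hβ.2 (not_lt.2 this.le)
  | cons s L ih =>
    have hs := hL s (by simp)
    have hL' : ∀ t ∈ L, t ∈ simpleRoots W c := fun t ht => hL t (by simp [ht])
    by_cases hβs : β = s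
    · subst hβs
      refine ⟨L, hL', by simp, ?_⟩
      rw [List.map_cons, List.prod_cons, ← mul_assoc, refl_mul_self, one_mul]
    · have hroot := map_mem_roots hs.1.1.2 hβ.1
      have hpos : 0 < ⟪refl s β, c⟫_ℝ := by
        rcases lt_or_gt_of_ne (hc _ hroot) with h | h
        · exact absurd (hs.2 β hβ (by rwa [inner_refl_right])) hβs
        · exact h
      obtain ⟨L', h1, h2, h3⟩ := ih hL' ⟨hroot, hpos⟩ (by
        rw [← inner_refl_right]
        simpa using hneg)
      refine ⟨s :: L', ?_, by simp [h2], ?_⟩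
      · intro t ht
        rcases List.mem_cons.1 ht with rfl | ht
        · exact hs
        · exact h1 t ht
      · have hinv : (refl s)⁻¹ = refl s := inv_eq_of_mul_eq_one_right (refl_mul_self s)
        rw [List.map_cons, List.prod_cons, h3, refl_map hβ.1.1, hinv, List.map_cons,
          List.prod_cons]
        simp only [← mul_assoc]
        rw [refl_mul_self, one_mul]

theorem exists_list_of_mem_closure {w : E ≃ₗᵢ[ℝ] E}
    (hw : w ∈ Subgroup.closure (refl '' simpleRoots W c)) :
    ∃ L : List E, (∀ s ∈ L, s ∈ simpleRoots W c) ∧ (L.map refl).prod = w := by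
  have hinv : ∀ s : E, (refl s)⁻¹ = refl s := fun s =>
    inv_eq_of_mul_eq_one_right (refl_mul_self s)
  induction hw using Subgroup.closure_induction_left with
  | one => exact ⟨[], by simp, by simp⟩
  | mul_left x hx y _ ih =>
    obtain ⟨s, hs, rfl⟩ := hx
    obtain ⟨L, hL, rfl⟩ := ih
    exact ⟨s :: L, by simpa using ⟨hs, hL⟩, by simp⟩
  | inv_mul_cancel x hx y _ ih =>
    obtain ⟨s, hs, rfl⟩ := hx
    obtain ⟨L, hL, rfl⟩ := ih
    exact ⟨s :: L, by simpa using ⟨hs, hL⟩, by simp [hinv]⟩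

/-- In a shortest word for `w` with first letter `s`, the tail sends `c` to the negative side of
`s`. Exchange then writes `w` with two letters fewer. -/
theorem eq_one_of_forall_nonneg [Finite W] (hc : ∀ α ∈ roots W, ⟪α, c⟫_ℝ ≠ 0)
    (hgen : W = Subgroup.closure (refl '' roots W)) {w : E ≃ₗᵢ[ℝ] E} (hw : w ∈ W)
    (h : ∀ β ∈ posRoots W c, 0 ≤ ⟪β, w c⟫_ℝ) : w = 1 := by
  have hle : W ≤ Subgroup.closure (refl '' simpleRoots W c) := by
    nth_rewrite 1 [hgen]
    rw [Subgroup.closure_le]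
    rintro _ ⟨α, hα, rfl⟩
    rcases lt_or_gt_of_ne (hc α hα) with h | h
    · rw [← refl_neg]
      exact refl_mem_closure_simpleRoots hc ⟨neg_mem_roots hα, by rw [inner_neg_left]; linarith⟩
    · exact refl_mem_closure_simpleRoots hc ⟨hα, h⟩
  have hex : ∃ k : ℕ, ∃ L : List E, L.length = k ∧ (∀ s ∈ L, s ∈ simpleRoots W c) ∧
      (L.map refl).prod = w := by
    obtain ⟨L, h1, h2⟩ := exists_list_of_mem_closure (hle hw)
    exact ⟨_, L, rfl, h1, h2⟩
  classical
  obtain ⟨L, hlen, hL, hprod⟩ := Nat.find_spec hex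
  rcases L with _ | ⟨s, L⟩
  · simpa using hprod.symm
  exfalso
  have hs := hL s (by simp)
  have hpr : (L.map refl).prod = refl s * w := by
    rw [← hprod, List.map_cons, List.prod_cons, ← mul_assoc, refl_mul_self, one_mul]
  have hsw : 0 < ⟪s, w c⟫_ℝ := by
    refine lt_of_le_of_ne (h s hs.1) (Ne.symm ?_)
    have := hc _ (map_mem_roots (W.inv_mem hw) hs.1.1)
    have e : ⟪w⁻¹ s, c⟫_ℝ = ⟪s, w c⟫_ℝ := by
      rw [← LinearIsometryEquiv.inner_map_map w]
      congr 1
      exact w.apply_symm_apply s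
    rwa [e] at this
  obtain ⟨L', h1, h2, h3⟩ := exchange hc L (fun t ht => hL t (by simp [ht])) hs.1 (by
    rw [hpr]
    change ⟪s, refl s (w c)⟫_ℝ < 0
    rw [inner_refl_right, refl_self, inner_neg_left]
    linarith)
  rw [hpr, ← mul_assoc, refl_mul_self, one_mul] at h3
  refine Nat.find_min hex (m := L'.length) ?_ ⟨L', rfl, h1, h3⟩
  rw [← hlen, List.length_cons]
  omega

theorem exists_generic [Finite W] : ∃ c : E, ∀ α ∈ roots W, ⟪α, c⟫_ℝ ≠ 0 := by
  have : Finite (roots W) := roots_finite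
  obtain ⟨f, hf⟩ := Module.Dual.exists_forall_mem_ne_zero_of_forall_exists (K := ℝ) (M := E)
    (⊤ : Submodule ℝ E) (fun α : roots W => (innerₗ E (α : E)))
    (fun α => ⟨α, trivial, by
      rw [innerₗ_apply_apply, real_inner_self_eq_norm_sq, α.2.1]; norm_num⟩)
  exact ⟨f, fun α hα => by simpa using hf.2 ⟨α, hα⟩⟩

/-- Two points of an orbit are equal unless a reflecting hyperplane strictly separates them. -/
theorem exists_root_separating [Finite W] (hgen : W = Subgroup.closure (refl '' roots W))
    {w : E ≃ₗᵢ[ℝ] E} (hw : w ∈ W) {b : E} (hb : w b ≠ b) :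
    ∃ α ∈ roots W, 0 < ⟪α, b⟫_ℝ ∧ ⟪α, w b⟫_ℝ < 0 := by
  by_contra! hsep
  obtain ⟨c₀, hc₀⟩ := exists_generic (W := W)
  have hsep' : ∀ α ∈ roots W, ⟪α, b⟫_ℝ < 0 → ⟪α, w b⟫_ℝ ≤ 0 := fun α hα h => by
    have := hsep (-α) (neg_mem_roots hα) (by rw [inner_neg_left]; linarith)
    rw [inner_neg_left] at this; linarith
  -- A generic perturbation of `b + w b`: as no mirror separates the two points, both lie in the
  -- closed chamber of `c`.
  obtain ⟨c, hc⟩ : ∃ c : E, ∀ α ∈ roots W, ⟪α, c⟫_ℝ ≠ 0 ∧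
      (0 < ⟪α, c⟫_ℝ → 0 ≤ ⟪α, b⟫_ℝ ∧ 0 ≤ ⟪α, w b⟫_ℝ) := by
    have hev : ∀ᶠ ε : ℝ in nhdsWithin 0 (Set.Ioi 0), ∀ α ∈ roots W,
        ⟪α, b + w b + ε • c₀⟫_ℝ ≠ 0 ∧
          (0 < ⟪α, b + w b + ε • c₀⟫_ℝ → 0 ≤ ⟪α, b⟫_ℝ ∧ 0 ≤ ⟪α, w b⟫_ℝ) := by
      rw [Filter.eventually_all_finite roots_finite]
      intro α hα
      have hcont : Filter.Tendsto (fun ε : ℝ => ⟪α, b + w b + ε • c₀⟫_ℝ)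
          (nhdsWithin 0 (Set.Ioi 0)) (nhds ⟪α, b + w b⟫_ℝ) := by
        have : Continuous (fun ε : ℝ => ⟪α, b + w b + ε • c₀⟫_ℝ) := by fun_prop
        have h := this.tendsto 0
        simp only [zero_smul, add_zero] at h
        exact h.mono_left nhdsWithin_le_nhds
      rcases lt_trichotomy ⟪α, b + w b⟫_ℝ 0 with h | h | h
      · filter_upwards [hcont.eventually (gt_mem_nhds h)] with ε hε
        exact ⟨hε.ne, fun h' => absurd h' (not_lt.2 hε.le)⟩
      · filter_upwards [self_mem_nhdsWithin] with ε hε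
        have hε : 0 < ε := hε
        rw [inner_add_right _ _ (ε • c₀), h, zero_add, inner_smul_right]
        refine ⟨mul_ne_zero hε.ne' (hc₀ α hα), fun _ => ?_⟩
        rw [inner_add_right] at h
        constructor <;> by_contra! h'
        · have := hsep' α hα h'
          linarith
        · have := hsep α hα (by linarith)
          linarith
      · filter_upwards [hcont.eventually (lt_mem_nhds h)] with ε hε
        refine ⟨hε.ne', fun _ => ?_⟩
        rw [inner_add_right] at h
        constructor <;> by_contra! h'
        · have := hsep' α hα h'
          linarith
        · have := hsep α hα (by linarith)
          linarith
    obtain ⟨ε, hε⟩ := hev.exists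
    exact ⟨_, hε⟩
  -- Correct `w` by the stabilizer of `b` so that `w (u c)` is as close to `c` as possible; it then
  -- lies in the chamber of `c`.
  obtain ⟨u, ⟨hu, hub⟩, hmax⟩ := Set.exists_max_image {u | u ∈ W ∧ u b = b}
    (fun u => ⟪w (u c), c⟫_ℝ)
    (Set.Finite.subset (Set.toFinite (W : Set (E ≃ₗᵢ[ℝ] E))) fun u hu => hu.1)
    ⟨1, W.one_mem, rfl⟩
  have hone : w * u = 1 := by
    refine eq_one_of_forall_nonneg (fun α hα => (hc α hα).1) hgen (W.mul_mem hw hu) ?_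
    intro β hβ
    by_contra! hneg
    change ⟪β, w (u c)⟫_ℝ < 0 at hneg
    obtain ⟨α, rfl⟩ := w.surjective β
    have hα : α ∈ roots W := by
      have := map_mem_roots (W.inv_mem hw) hβ.1
      rwa [show w⁻¹ (w α) = α from w.symm_apply_apply α] at this
    obtain ⟨α', rfl⟩ := u.surjective α
    have hα' : α' ∈ roots W := by
      have := map_mem_roots (W.inv_mem hu) hα
      rwa [show u⁻¹ (u α') = α' from u.symm_apply_apply α'] at this
    have h1 := ((hc _ hβ.1).2 hβ.2).2
    rw [LinearIsometryEquiv.inner_map_map] at h1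
    have h2 := ((hc _ (neg_mem_roots hα')).2 (by
      rw [inner_neg_left]
      rw [LinearIsometryEquiv.inner_map_map, LinearIsometryEquiv.inner_map_map] at hneg
      linarith)).1
    rw [inner_neg_left, ← LinearIsometryEquiv.inner_map_map u, hub] at h2
    -- A mirror still separating `c` from `w (u c)` pulls back to one through `b`; reflecting in it
    -- contradicts maximality of `u`.
    have h3 : ⟪u α', b⟫_ℝ = 0 := by linarith
    have h4 := hmax (refl (u α') * u) ⟨W.mul_mem hα.2 hu, by
      change refl (u α') (u b) = b
      rw [hub, refl_apply hα.1, h3]; simp⟩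
    change ⟪w (refl (u α') (u c)), c⟫_ℝ ≤ ⟪w (u c), c⟫_ℝ at h4
    rw [refl_apply hα.1, map_sub, map_smul, inner_sub_left, inner_smul_left] at h4
    simp only [conj_trivial] at h4
    have h5 := hβ.2
    rw [LinearIsometryEquiv.inner_map_map] at hneg
    nlinarith
  apply hb
  calc w b = w (u b) := by rw [hub]
    _ = (w * u) b := rfl
    _ = b := by rw [hone]; rfl

end FiniteReflection

namespace FiniteReflection

open scoped InnerProductSpace

variable {E : Type*} [NormedAddCommGroup E] [InnerProductSpace ℝ E]

/-! ### Faces of a polytope and their vertex means -/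

/-- The arithmetic mean of a finite set of points. -/
noncomputable def mean (A : Set E) : E := (A.ncard : ℝ)⁻¹ • ∑ᶠ v ∈ A, v

theorem mean_coe (s : Finset E) : mean (s : Set E) = (s.card : ℝ)⁻¹ • ∑ v ∈ s, v := by
  rw [mean, Set.ncard_coe_finset, finsum_mem_coe_finset]

theorem mean_le {A : Set E} (hA : A.Finite) (hne : A.Nonempty) (l : E →ₗ[ℝ] ℝ) {M : ℝ}
    (h : ∀ v ∈ A, l v ≤ M) : l (mean A) ≤ M := by
  lift A to Finset E using hA
  have hpos : (0 : ℝ) < A.card := by exact_mod_cast (Finset.coe_nonempty.1 hne).card_pos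
  rw [mean_coe, map_smul, map_sum, smul_eq_mul, inv_mul_le_iff₀ hpos, ← nsmul_eq_mul]
  exact Finset.sum_le_card_nsmul _ _ _ h

theorem mean_lt {A : Set E} (hA : A.Finite) (l : E →ₗ[ℝ] ℝ) {M : ℝ}
    (h : ∀ v ∈ A, l v ≤ M) (h' : ∃ v ∈ A, l v < M) : l (mean A) < M := by
  lift A to Finset E using hA
  have hne : A.Nonempty := by obtain ⟨v, hv, -⟩ := h'; exact ⟨v, hv⟩
  have hpos : (0 : ℝ) < A.card := by exact_mod_cast hne.card_pos
  rw [mean_coe, map_smul, map_sum, smul_eq_mul, inv_mul_lt_iff₀ hpos, ← nsmul_eq_mul,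
    ← Finset.sum_const]
  exact Finset.sum_lt_sum h h'

theorem mean_mem_convexHull {A : Set E} (hA : A.Finite) (hne : A.Nonempty) :
    mean A ∈ convexHull ℝ A := by
  lift A to Finset E using hA
  have hpos : (0 : ℝ) < A.card := by exact_mod_cast (Finset.coe_nonempty.1 hne).card_pos
  rw [mean_coe, Finset.smul_sum]
  refine (convex_convexHull ℝ _).sum_mem (fun _ _ => by positivity) ?_
    (fun v hv => subset_convexHull ℝ _ hv)
  rw [Finset.sum_const, nsmul_eq_mul, mul_inv_cancel₀ hpos.ne']

theorem mean_image {A : Set E} (hA : A.Finite) (w : E ≃ₗᵢ[ℝ] E) : mean (w '' A) = w (mean A) := by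
  classical
  lift A to Finset E using hA
  rw [← Finset.coe_image, mean_coe, mean_coe, Finset.card_image_of_injective _ w.injective,
    Finset.sum_image (fun x _ y _ h => w.injective h), map_smul, map_sum]

/-- A nonempty exposed subset. -/
def IsFace (P F : Set E) : Prop := IsExposed ℝ P F ∧ F.Nonempty

theorem IsFace.exists_functional {P F : Set E} (hF : IsFace P F) :
    ∃ (l : StrongDual ℝ E) (M : ℝ), (∀ y ∈ P, l y ≤ M) ∧ F = {y ∈ P | l y = M} := by
  obtain ⟨l, hl⟩ := hF.1 hF.2
  obtain ⟨y₀, hy₀⟩ := hF.2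
  have h0 := hy₀
  rw [hl] at h0
  refine ⟨l, l y₀, h0.2, ?_⟩
  rw [hl]
  ext y
  constructor
  · rintro ⟨hy, h⟩
    exact ⟨hy, le_antisymm (h0.2 y hy) (h y₀ h0.1)⟩
  · rintro ⟨hy, h⟩
    exact ⟨hy, fun z hz => h ▸ h0.2 z hz⟩

theorem isFace_of_functional {P : Set E} {l : StrongDual ℝ E} {M : ℝ} (h : ∀ y ∈ P, l y ≤ M)
    (hne : {y ∈ P | l y = M}.Nonempty) : IsFace P {y ∈ P | l y = M} := by
  refine ⟨fun _ => ⟨l, ?_⟩, hne⟩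
  obtain ⟨y₀, hy₀, h0⟩ := hne
  ext y
  constructor
  · rintro ⟨hy, h1⟩
    exact ⟨hy, fun z hz => h1 ▸ h z hz⟩
  · rintro ⟨hy, h1⟩
    exact ⟨hy, le_antisymm (h y hy) (h0 ▸ h1 y₀ hy₀)⟩

theorem IsFace.subset {P F : Set E} (hF : IsFace P F) : F ⊆ P := hF.1.subset

theorem convexHull_subset_halfSpace {V : Set E} (l : StrongDual ℝ E) {M : ℝ}
    (h : ∀ v ∈ V, l v ≤ M) : ∀ y ∈ convexHull ℝ V, l y ≤ M :=
  convexHull_min (t := {y | l y ≤ M}) h (convex_halfSpace_le l.toLinearMap.isLinear M)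

variable {V : Set E}

theorem IsFace.convex {F : Set E} (hF : IsFace (convexHull ℝ V) F) : Convex ℝ F :=
  hF.1.convex (convex_convexHull ℝ V)

/-- Krein–Milman: extreme points of `F` are extreme in the whole hull, hence lie in `V`. -/
theorem IsFace.eq_convexHull (hV : V.Finite) {F : Set E} (hF : IsFace (convexHull ℝ V) F) :
    F = convexHull ℝ (V ∩ F) := by
  refine Set.Subset.antisymm ?_ (convexHull_min Set.inter_subset_right hF.convex)
  have hc : IsCompact F := hF.1.isCompact (hV.isCompact_convexHull ℝ)
  have hext : F.extremePoints ℝ ⊆ V ∩ F := fun y hy =>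
    ⟨extremePoints_convexHull_subset (hF.1.isExtreme.extremePoints_subset_extremePoints hy), hy.1⟩
  conv_lhs => rw [← closure_convexHull_extremePoints hc hF.convex]
  exact closure_minimal (convexHull_mono hext)
    ((hV.subset Set.inter_subset_left).isClosed_convexHull ℝ)

theorem IsFace.inter_nonempty (hV : V.Finite) {F : Set E} (hF : IsFace (convexHull ℝ V) F) :
    (V ∩ F).Nonempty := by
  have := hF.2
  rw [hF.eq_convexHull hV] at this
  exact convexHull_nonempty_iff.1 this

theorem IsFace.mean_mem (hV : V.Finite) {F : Set E} (hF : IsFace (convexHull ℝ V) F) :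
    mean (V ∩ F) ∈ F := by
  have := mean_mem_convexHull (hV.subset Set.inter_subset_left) (hF.inter_nonempty hV)
  rwa [← hF.eq_convexHull hV] at this

/-- A mean attains the maximum defining `G` only if every averaged point does. -/
theorem IsFace.subset_of_mean_mem (hV : V.Finite) {F G : Set E}
    (hF : IsFace (convexHull ℝ V) F) (hG : IsFace (convexHull ℝ V) G)
    (h : mean (V ∩ F) ∈ G) : F ⊆ G := by
  rw [hF.eq_convexHull hV]
  refine convexHull_min ?_ hG.convex
  intro v hv
  obtain ⟨l, M, hl, hGl⟩ := hG.exists_functional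
  by_contra hvG
  have hle : ∀ v ∈ V ∩ F, l v ≤ M := fun v hv => hl v (subset_convexHull ℝ V hv.1)
  have := mean_lt (hV.subset Set.inter_subset_left) l.toLinearMap hle ⟨v, hv, by
    refine lt_of_le_of_ne (hle v hv) fun h => hvG ?_
    rw [hGl]
    exact ⟨subset_convexHull ℝ V hv.1, h⟩⟩
  rw [hGl] at h
  exact absurd h.2 this.ne

theorem IsFace.eq_of_mean_eq (hV : V.Finite) {F G : Set E}
    (hF : IsFace (convexHull ℝ V) F) (hG : IsFace (convexHull ℝ V) G)
    (h : mean (V ∩ F) = mean (V ∩ G)) : F = G :=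
  (hF.subset_of_mean_mem hV hG (h ▸ hG.mean_mem hV)).antisymm
    (hG.subset_of_mean_mem hV hF (h ▸ hF.mean_mem hV))

theorem image_convexHull_eq {w : E ≃ₗᵢ[ℝ] E} (hw : w '' V = V) :
    w '' convexHull ℝ V = convexHull ℝ V := by
  have := w.toLinearEquiv.toLinearMap.image_convexHull V
  have h2 : (w.toLinearEquiv.toLinearMap : E → E) = w := rfl
  rw [h2, hw] at this
  exact this

theorem IsFace.image {P F : Set E} {w : E ≃ₗᵢ[ℝ] E} (hw : w '' P = P) (hF : IsFace P F) :
    IsFace P (w '' F) := by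
  obtain ⟨l, M, hl, hFl⟩ := hF.exists_functional
  have key : w '' F = {y ∈ P | (l.comp (w.symm.toContinuousLinearEquiv : E →L[ℝ] E)) y = M} := by
    ext y
    constructor
    · rintro ⟨z, hz, rfl⟩
      rw [hFl] at hz
      refine ⟨hw ▸ Set.mem_image_of_mem w hz.1, ?_⟩
      simpa using hz.2
    · rintro ⟨hy, h⟩
      rw [← hw] at hy
      obtain ⟨z, hz, rfl⟩ := hy
      refine ⟨z, ?_, rfl⟩
      rw [hFl]
      exact ⟨hz, by simpa using h⟩
  rw [key]
  refine isFace_of_functional ?_ (key ▸ hF.2.image w)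
  intro y hy
  rw [← hw] at hy
  obtain ⟨z, hz, rfl⟩ := hy
  simpa using hl z hz

theorem finrank_vectorSpan_image (w : E ≃ₗᵢ[ℝ] E) (F : Set E) :
    Module.finrank ℝ (vectorSpan ℝ (w '' F)) = Module.finrank ℝ (vectorSpan ℝ F) := by
  have h := AffineMap.map_vectorSpan
    (f := w.toLinearEquiv.toLinearMap.toAffineMap) (s := F)
  have h2 : ((w.toLinearEquiv.toLinearMap.toAffineMap : E →ᵃ[ℝ] E) : E → E) = w := rfl
  rw [h2] at h
  rw [← h]
  exact w.toLinearEquiv.finrank_map_eq (vectorSpan ℝ F)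

theorem mean_inter_image (hV : V.Finite) {w : E ≃ₗᵢ[ℝ] E} (hw : w '' V = V) (F : Set E) :
    mean (V ∩ w '' F) = w (mean (V ∩ F)) := by
  rw [← mean_image (hV.subset Set.inter_subset_left), Set.image_inter w.injective, hw]

/-! ### Transitivity of the pointwise stabilizer -/

variable {W : Subgroup (E ≃ₗᵢ[ℝ] E)}

/-- A face whose mean vertex lies strictly on one side of a mirror lies weakly on that side. -/
theorem IsFace.inner_nonneg (hV : V.Finite) (hWV : ∀ w ∈ W, w '' V = V) {F : Set E}
    (hF : IsFace (convexHull ℝ V) F) {α : E} (hα : α ∈ roots W)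
    (h : 0 < ⟪α, mean (V ∩ F)⟫_ℝ) : ∀ y ∈ F, 0 ≤ ⟪α, y⟫_ℝ := by
  intro y hy
  by_contra! hneg
  obtain ⟨v, hv, hvpos⟩ : ∃ v ∈ V ∩ F, 0 < ⟪α, v⟫_ℝ := by
    by_contra! hle
    have := mean_le (hV.subset Set.inter_subset_left) (hF.inter_nonempty hV) (innerₗ E α) (M := 0)
      (by simpa using hle)
    rw [innerₗ_apply_apply] at this
    linarith
  obtain ⟨l, M, hl, hFl⟩ := hF.exists_functional
  have hP := image_convexHull_eq (hWV _ hα.2)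
  have hmem : ∀ z ∈ convexHull ℝ V, refl α z ∈ convexHull ℝ V := fun z hz => by
    rw [← hP]; exact Set.mem_image_of_mem _ hz
  have hlr : ∀ z, l (refl α z) = l z - 2 * ⟪α, z⟫_ℝ * l α := fun z => by
    rw [refl_apply hα.1, map_sub, map_smul, smul_eq_mul]
  have hF' : ∀ z ∈ F, z ∈ convexHull ℝ V ∧ l z = M := fun z hz => by rw [hFl] at hz; exact hz
  have h1 := hl _ (hmem v (hF' v hv.2).1)
  have h2 := hl _ (hmem y (hF' y hy).1)
  rw [hlr, (hF' v hv.2).2] at h1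
  rw [hlr, (hF' y hy).2] at h2
  -- Points of `F` strictly on both sides of the mirror force `l α ≥ 0` and `l α ≤ 0`. Then the
  -- reflection preserves `F`, and the mean lies on the mirror.
  have h0 : l α = 0 := by
    apply le_antisymm <;> by_contra! h3 <;> nlinarith
  have hsub : ∀ z ∈ F, refl α z ∈ F := fun z hz => by
    rw [hFl]
    refine ⟨hmem z (hF' z hz).1, ?_⟩
    rw [hlr, h0, (hF' z hz).2]; ring
  have himg : refl α '' F = F := by
    apply Set.Subset.antisymm
    · rintro _ ⟨z, hz, rfl⟩; exact hsub z hz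
    · intro z hz; exact ⟨refl α z, hsub z hz, refl_refl α z⟩
  have hfix := mean_inter_image hV (hWV _ hα.2) F
  rw [himg] at hfix
  have : ⟪α, mean (V ∩ F)⟫_ℝ = -⟪α, mean (V ∩ F)⟫_ℝ := by
    conv_lhs => rw [hfix, inner_refl_right, refl_self, inner_neg_left]
  linarith

/-- The pointwise stabiliser of a face acts transitively on the members of a given orbit of faces
that contain it. -/
theorem exists_fixing_image_eq [Finite W] (hgen : W = Subgroup.closure (refl '' roots W))
    (hV : V.Finite) (hWV : ∀ w ∈ W, w '' V = V) {f G G' : Set E}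
    (hG : IsFace (convexHull ℝ V) G) (hG' : IsFace (convexHull ℝ V) G') (hfG : f ⊆ G)
    (hfG' : f ⊆ G') {w : E ≃ₗᵢ[ℝ] E} (hw : w ∈ W) (hwG : w '' G = G') :
    ∃ u ∈ W, (∀ x ∈ f, u x = x) ∧ u '' G = G' := by
  obtain ⟨u, ⟨hu, hfix⟩, hmax⟩ := Set.exists_max_image {u | u ∈ W ∧ ∀ x ∈ f, u x = x}
    (fun u => ⟪u (mean (V ∩ G)), mean (V ∩ G')⟫_ℝ)
    (Set.Finite.subset (Set.toFinite (W : Set (E ≃ₗᵢ[ℝ] E))) fun u hu => hu.1)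
    ⟨1, W.one_mem, fun _ _ => rfl⟩
  have huG : IsFace (convexHull ℝ V) (u '' G) := hG.image (image_convexHull_eq (hWV u hu))
  refine ⟨u, hu, hfix, huG.eq_of_mean_eq hV hG' ?_⟩
  by_contra hne
  have hfu : f ⊆ u '' G := fun x hx => ⟨x, hfG hx, hfix x hx⟩
  have e : (w * u⁻¹) (mean (V ∩ u '' G)) = mean (V ∩ G') := by
    rw [mean_inter_image hV (hWV u hu), ← hwG, mean_inter_image hV (hWV w hw)]
    change w (u.symm (u _)) = _
    rw [u.symm_apply_apply]
  obtain ⟨α, hα, h1, h2⟩ := exists_root_separating hgen (W.mul_mem hw (W.inv_mem hu))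
    (b := mean (V ∩ u '' G)) (by rw [e]; exact Ne.symm hne)
  rw [e] at h2
  -- `f` lies in two faces on opposite sides of the mirror, so composing `u` with the reflection
  -- keeps `f` fixed.
  have h0 : ∀ x ∈ f, ⟪α, x⟫_ℝ = 0 := fun x hx => by
    have h3 := huG.inner_nonneg hV hWV hα h1 x (hfu hx)
    have h4 := hG'.inner_nonneg hV hWV (neg_mem_roots hα)
      (by rw [inner_neg_left]; linarith) x (hfG' hx)
    rw [inner_neg_left] at h4
    linarith
  have h5 := hmax (refl α * u) ⟨W.mul_mem hα.2 hu, fun x hx => by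
    change refl α (u x) = x
    rw [hfix x hx, refl_apply hα.1, h0 x hx]; simp⟩
  change ⟪refl α (u (mean (V ∩ G))), _⟫_ℝ ≤ _ at h5
  rw [← mean_inter_image hV (hWV u hu), refl_apply hα.1, inner_sub_left, inner_smul_left] at h5
  simp only [conj_trivial] at h5
  nlinarith

/-! ### Dimension and chains of faces -/

theorem vectorSpan_le_ker {f : Set E} {l : E →ₗ[ℝ] ℝ} {M : ℝ} (h : ∀ y ∈ f, l y = M) :
    vectorSpan ℝ f ≤ LinearMap.ker l := by
  rw [vectorSpan_def, Submodule.span_le]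
  rintro _ ⟨a, ha, b, hb, rfl⟩
  simp [h a ha, h b hb]

theorem sub_notMem_vectorSpan {P f : Set E} (hf : IsFace P f) {y₀ y : E} (hy₀ : y₀ ∈ f)
    (hy : y ∈ P) (hyf : y ∉ f) : y - y₀ ∉ vectorSpan ℝ f := by
  obtain ⟨l, M, hl, hfl⟩ := hf.exists_functional
  have h0 : ∀ z ∈ f, l z = M := fun z hz => by rw [hfl] at hz; exact hz.2
  intro h
  have := vectorSpan_le_ker (l := l.toLinearMap) h0 h
  apply hyf
  rw [hfl]
  refine ⟨hy, ?_⟩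
  rw [LinearMap.mem_ker, map_sub] at this
  have h1 := h0 y₀ hy₀
  change l y - l y₀ = 0 at this
  linarith

variable [FiniteDimensional ℝ E]

theorem finrank_vectorSpan_lt {P f G : Set E} (hf : IsFace P f) (hGP : G ⊆ P) (hfG : f ⊂ G) :
    Module.finrank ℝ (vectorSpan ℝ f) < Module.finrank ℝ (vectorSpan ℝ G) := by
  obtain ⟨y, hy, hyf⟩ := Set.exists_of_ssubset hfG
  obtain ⟨y₀, hy₀⟩ := hf.2
  refine Submodule.finrank_lt_finrank_of_lt (lt_of_le_of_ne (vectorSpan_mono ℝ hfG.1) fun h => ?_)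
  refine sub_notMem_vectorSpan hf hy₀ (hGP hy) hyf ?_
  rw [h]
  exact vsub_mem_vectorSpan ℝ hy (hfG.1 hy₀)

/-- An isometry fixing a facet of a face pointwise and preserving the face fixes the face
pointwise. -/
theorem fixes_of_fixes_facet (hV : V.Finite) {f G : Set E} (hf : IsFace (convexHull ℝ V) f)
    (hG : IsFace (convexHull ℝ V) G) (hfG : f ⊂ G)
    (hdim : Module.finrank ℝ (vectorSpan ℝ G) ≤ Module.finrank ℝ (vectorSpan ℝ f) + 1)
    {w : E ≃ₗᵢ[ℝ] E} (hwV : w '' V = V) (hfix : ∀ x ∈ f, w x = x) (hwG : w '' G = G) :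
    ∀ x ∈ G, w x = x := by
  obtain ⟨y₀, hy₀⟩ := hf.2
  set b := mean (V ∩ G) with hb
  have hbG : b ∈ G := hG.mean_mem hV
  have hbf : b ∉ f := fun h => hfG.2 (hG.subset_of_mean_mem hV hf h)
  have hwb : w b = b := by rw [hb, ← mean_inter_image hV hwV, hwG]
  have hd := sub_notMem_vectorSpan hf hy₀ (hG.subset hbG) hbf
  let K : Submodule ℝ E := LinearMap.eqLocus w.toLinearEquiv.toLinearMap LinearMap.id
  have hK : ∀ x, x ∈ K ↔ w x = x := fun x => Iff.rfl
  have hfK : vectorSpan ℝ f ≤ K := by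
    rw [vectorSpan_def, Submodule.span_le]
    rintro _ ⟨a, ha, b, hb, rfl⟩
    change w (a - b) = a - b
    rw [map_sub, hfix a ha, hfix b hb]
  have hle : vectorSpan ℝ f ⊔ Submodule.span ℝ {b - y₀} ≤ vectorSpan ℝ G := by
    refine sup_le (vectorSpan_mono ℝ hfG.1) ?_
    rw [Submodule.span_singleton_le_iff_mem]
    exact vsub_mem_vectorSpan ℝ hbG (hfG.1 hy₀)
  have hlt : vectorSpan ℝ f < vectorSpan ℝ f ⊔ Submodule.span ℝ {b - y₀} := by
    refine lt_of_le_of_ne le_sup_left fun h => hd ?_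
    rw [h]
    exact Submodule.mem_sup_right (Submodule.mem_span_singleton_self _)
  have heq := Submodule.eq_of_le_of_finrank_le hle
    (by have := Submodule.finrank_lt_finrank_of_lt hlt; omega)
  have hGK : vectorSpan ℝ G ≤ K := by
    rw [← heq]
    refine sup_le hfK ?_
    rw [Submodule.span_singleton_le_iff_mem, hK, map_sub, hwb, hfix y₀ hy₀]
  intro x hx
  have := hGK (vsub_mem_vectorSpan ℝ hx (hfG.1 hy₀))
  rw [hK, vsub_eq_sub, map_sub, hfix y₀ hy₀] at this
  exact sub_left_injective this

/-- Tilt the functional of `f` by `m`, constant on `f` and `y₁` but larger at `y₂`, until the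
supporting hyperplane meets a new vertex `v₀` of `G`. The new face contains `f` and `v₀` but not
`y₁`. -/
theorem exists_face_between (hV : V.Finite) {f G : Set E} (hf : IsFace (convexHull ℝ V) f)
    (hG : IsFace (convexHull ℝ V) G) (hfG : f ⊂ G)
    (hdim : Module.finrank ℝ (vectorSpan ℝ f) + 1 < Module.finrank ℝ (vectorSpan ℝ G)) :
    ∃ G', IsFace (convexHull ℝ V) G' ∧ f ⊂ G' ∧ G' ⊂ G := by
  obtain ⟨y₀, hy₀⟩ := hf.2
  obtain ⟨y₁, hy₁, hy₁f⟩ := Set.exists_of_ssubset hfG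
  obtain ⟨lf, Mf, hlf, hfeq⟩ := hf.exists_functional
  obtain ⟨lG, MG, hlG, hGeq⟩ := hG.exists_functional
  have hf' : ∀ y ∈ f, lf y = Mf := fun y hy => by rw [hfeq] at hy; exact hy.2
  have hG' : ∀ y ∈ G, lG y = MG := fun y hy => by rw [hGeq] at hy; exact hy.2
  set Q := vectorSpan ℝ f ⊔ Submodule.span ℝ {y₁ - y₀} with hQ
  obtain ⟨y₂, hy₂, hy₂Q⟩ : ∃ y₂ ∈ G, y₂ - y₀ ∉ Q := by
    by_contra! hall
    have hle : vectorSpan ℝ G ≤ Q := by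
      rw [vectorSpan_def, Submodule.span_le]
      rintro _ ⟨a, ha, b, hb, rfl⟩
      have := Q.sub_mem (hall a ha) (hall b hb)
      simpa using this
    have h1 := Submodule.finrank_mono hle
    have h2 := Submodule.finrank_add_le_finrank_add_finrank (vectorSpan ℝ f)
      (Submodule.span ℝ {y₁ - y₀})
    have h3 := finrank_span_singleton (K := ℝ)
      (sub_ne_zero.2 fun h : y₁ = y₀ => hy₁f (h ▸ hy₀))
    rw [← hQ] at h2
    omega
  obtain ⟨m, hm2, hmQ⟩ : ∃ m : StrongDual ℝ E, 0 < m (y₂ - y₀) ∧ ∀ z ∈ Q, m z = 0 := by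
    obtain ⟨m, hm, hQm⟩ := Submodule.exists_le_ker_of_notMem hy₂Q
    rcases lt_or_gt_of_ne hm with h | h
    · exact ⟨-LinearMap.toContinuousLinearMap m, by simpa using h, fun z hz => by
        have := hQm hz
        simpa using this⟩
    · exact ⟨LinearMap.toContinuousLinearMap m, by simpa using h, fun z hz => by
        have := hQm hz
        simpa using this⟩
  have hmf : ∀ y ∈ f, m y = m y₀ := fun y hy => by
    have := hmQ (y - y₀) (Submodule.mem_sup_left (vsub_mem_vectorSpan ℝ hy hy₀))
    rw [map_sub] at this; linarith
  have hm1 : m y₁ = m y₀ := by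
    have := hmQ (y₁ - y₀) (Submodule.mem_sup_right (Submodule.mem_span_singleton_self _))
    rw [map_sub] at this; linarith
  rw [map_sub] at hm2
  have hA : {v ∈ V ∩ G | m y₀ < m v}.Nonempty := by
    by_contra hempty
    have hle : ∀ v ∈ V ∩ G, m v ≤ m y₀ := fun v hv => by
      by_contra! h
      exact hempty ⟨v, hv, h⟩
    have h2 := hy₂
    rw [hG.eq_convexHull hV] at h2
    have := convexHull_subset_halfSpace m hle y₂ h2
    linarith
  obtain ⟨v₀, ⟨hv₀, hmv₀⟩, hmin⟩ := Set.exists_min_image _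
    (fun v => (Mf - lf v) / (m v - m y₀))
    ((hV.subset Set.inter_subset_left).subset fun v hv => hv.1) hA
  -- The largest tilt that keeps all vertices of `G` below the supporting level.
  set t := (Mf - lf v₀) / (m v₀ - m y₀) with ht
  have hVP : ∀ v ∈ V, v ∈ convexHull ℝ V := fun v hv => subset_convexHull ℝ V hv
  have ht0 : 0 ≤ t := div_nonneg (by linarith [hlf v₀ (hVP _ hv₀.1)]) (by linarith)
  have htv₀ : lf v₀ + t * m v₀ = Mf + t * m y₀ := by
    have : t * (m v₀ - m y₀) = Mf - lf v₀ := by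
      rw [ht]; exact div_mul_cancel₀ _ (by linarith)
    linarith
  have hle : ∀ v ∈ V ∩ G, lf v + t * m v ≤ Mf + t * m y₀ := fun v hv => by
    by_cases h : m y₀ < m v
    · have := hmin v ⟨hv, h⟩
      rw [le_div_iff₀ (by linarith)] at this
      linarith
    · have h1 := hlf v (hVP _ hv.1)
      have := mul_le_mul_of_nonneg_left (not_lt.1 h) ht0
      linarith
  -- A large multiple of `lG` keeps vertices outside `G` strictly below the maximum; quotients with
  -- zero denominator occur only on `G` and are never used.
  obtain ⟨N₀, hN₀⟩ := (hV.image fun v =>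
    (lf v + t * m v - (Mf + t * m y₀)) / (MG - lG v)).bddAbove
  set N := N₀ + 1 with hN
  let L : StrongDual ℝ E := N • lG + lf + t • m
  have hL : ∀ y, L y = N * lG y + lf y + t * m y := fun y => by simp [L]
  set M := N * MG + Mf + t * m y₀ with hM
  have hLG : ∀ v ∈ V, v ∉ G → L v < M := fun v hv hvG => by
    have h1 : lG v < MG := lt_of_le_of_ne (hlG v (hVP v hv)) fun h => hvG (by
      rw [hGeq]; exact ⟨hVP v hv, h⟩)
    have h2 := hN₀ (Set.mem_image_of_mem _ hv)
    rw [div_le_iff₀ (by linarith)] at h2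
    rw [hL]
    nlinarith
  have hLV : ∀ v ∈ V, L v ≤ M := fun v hv => by
    by_cases hvG : v ∈ G
    · rw [hL, hG' v hvG]
      have := hle v ⟨hv, hvG⟩
      linarith
    · exact (hLG v hv hvG).le
  have hfL : f ⊆ {y ∈ convexHull ℝ V | L y = M} := fun y hy => by
    refine ⟨hf.subset hy, ?_⟩
    rw [hL, hG' y (hfG.1 hy), hf' y hy, hmf y hy]
  have hface := isFace_of_functional (convexHull_subset_halfSpace L hLV) (hf.2.mono hfL)
  refine ⟨_, hface, Set.ssubset_iff_subset_ne.2 ⟨hfL, ?_⟩, Set.ssubset_iff_subset_ne.2 ⟨?_, ?_⟩⟩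
  · intro h
    have hv : v₀ ∈ f := by
      rw [h]
      refine ⟨hVP _ hv₀.1, ?_⟩
      rw [hL, hG' v₀ hv₀.2]
      linarith
    have := hmf v₀ hv
    linarith
  · rw [hface.eq_convexHull hV]
    refine convexHull_min ?_ hG.convex
    rintro v ⟨hv, -, hvL⟩
    by_contra hvG
    exact (hLG v hv hvG).ne hvL
  · intro h
    have := hy₁
    rw [← h] at this
    have h2 := this.2
    rw [hL, hG' y₁ hy₁, hm1] at h2
    apply hy₁f
    rw [hfeq]
    exact ⟨hG.subset hy₁, by linarith⟩

/-- A face of least dimension strictly above `f` admits nothing in between. -/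
theorem exists_face_succ (hV : V.Finite) {f : Set E} (hf : IsFace (convexHull ℝ V) f)
    (hne : f ≠ convexHull ℝ V) :
    ∃ G, IsFace (convexHull ℝ V) G ∧ f ⊂ G ∧
      Module.finrank ℝ (vectorSpan ℝ G) = Module.finrank ℝ (vectorSpan ℝ f) + 1 := by
  classical
  have hex : ∃ k, ∃ G, IsFace (convexHull ℝ V) G ∧ f ⊂ G ∧
      Module.finrank ℝ (vectorSpan ℝ G) = k :=
    ⟨_, convexHull ℝ V, ⟨IsExposed.refl _, hf.2.mono hf.subset⟩,
      Set.ssubset_iff_subset_ne.2 ⟨hf.subset, hne⟩, rfl⟩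
  obtain ⟨G, hG, hfG, hdim⟩ := Nat.find_spec hex
  refine ⟨G, hG, hfG, ?_⟩
  by_contra h
  have hlt := finrank_vectorSpan_lt hf hG.subset hfG
  obtain ⟨G', hG', h1, h2⟩ := exists_face_between hV hf hG hfG (by omega)
  refine Nat.find_min hex (m := Module.finrank ℝ (vectorSpan ℝ G')) ?_ ⟨G', hG', h1, rfl⟩
  rw [← hdim]
  exact finrank_vectorSpan_lt hG' hG.subset h2

end FiniteReflection

namespace FiniteReflection

/-! ### Orbit counting -/

variable {n : ℕ} {W : Subgroup (EuclideanSpace ℝ (Fin n) ≃ₗᵢ[ℝ] EuclideanSpace ℝ (Fin n))}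

theorem eq_closure_roots (hW : IsFiniteReflectionGroup W) :
    W = Subgroup.closure (refl '' roots W) := by
  apply le_antisymm
  · nth_rewrite 1 [hW.generated]
    rw [Subgroup.closure_le]
    rintro s ⟨hs, v, hv, rfl⟩
    have hnorm : ‖v‖⁻¹ ≠ 0 := inv_ne_zero (norm_ne_zero_iff.2 hv)
    have e : refl (‖v‖⁻¹ • v) = (Submodule.span ℝ {v})ᗮ.reflection := refl_smul hnorm v
    refine Subgroup.subset_closure ⟨‖v‖⁻¹ • v, ⟨?_, by rw [e]; exact hs⟩, e⟩
    rw [norm_smul, norm_inv, norm_norm, inv_mul_cancel₀ (norm_ne_zero_iff.2 hv)]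
  · rw [Subgroup.closure_le]
    rintro _ ⟨α, hα, rfl⟩
    exact hα.2

theorem card_pointwiseStabilizer_image
    {w : EuclideanSpace ℝ (Fin n) ≃ₗᵢ[ℝ] EuclideanSpace ℝ (Fin n)}
    (hw : w ∈ W) (F : Set (EuclideanSpace ℝ (Fin n))) :
    Nat.card (pointwiseStabilizer W (w '' F)) = Nat.card (pointwiseStabilizer W F) := by
  have : pointwiseStabilizer W (w '' F) =
      (pointwiseStabilizer W F).map (MulAut.conj w).toMonoidHom := by
    ext u
    rw [Subgroup.mem_map_equiv]
    change (u ∈ W ∧ _) ↔ ((MulAut.conj w).symm u ∈ W ∧ _)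
    rw [MulAut.conj_symm_apply]
    constructor
    · rintro ⟨hu, h⟩
      refine ⟨mul_mem (mul_mem (inv_mem hw) hu) hw, fun x hx => ?_⟩
      change w.symm (u (w x)) = x
      rw [h _ (Set.mem_image_of_mem w hx), w.symm_apply_apply]
    · rintro ⟨hu, h⟩
      refine ⟨?_, ?_⟩
      · have := mul_mem (mul_mem hw hu) (inv_mem hw)
        simpa [mul_assoc] using this
      · rintro _ ⟨x, hx, rfl⟩
        have := h x hx
        change w.symm (u (w x)) = x at this
        rw [← w.symm_apply_eq, this]
  rw [this]
  exact Subgroup.card_map_of_injective (MulAut.conj w).injective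

/-- Orbit–stabiliser for a set of sets on which the pointwise stabiliser of `f` is transitive. -/
theorem card_pointwiseStabilizer_eq_mul {f G : Set (EuclideanSpace ℝ (Fin n))} (hfG : f ⊆ G)
    {X : Set (Set (EuclideanSpace ℝ (Fin n)))}
    (hX : ∀ G', G' ∈ X ↔ ∃ u ∈ pointwiseStabilizer W f, u '' G = G')
    (hstab : ∀ u ∈ pointwiseStabilizer W f, u '' G = G → ∀ x ∈ G, u x = x) :
    Nat.card (pointwiseStabilizer W f) = X.ncard * Nat.card (pointwiseStabilizer W G) := by
  have hle : pointwiseStabilizer W G ≤ pointwiseStabilizer W f :=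
    fun u hu => ⟨hu.1, fun x hx => hu.2 x (hfG hx)⟩
  -- Left cosets of the stabilizer of `G` correspond to the images of `G`.
  have hiff : ∀ a b : pointwiseStabilizer W f,
      a⁻¹ * b ∈ (pointwiseStabilizer W G).subgroupOf (pointwiseStabilizer W f) ↔
        a.1 '' G = b.1 '' G := by
    intro a b
    rw [Subgroup.mem_subgroupOf]
    have hab : ∀ x, ((a⁻¹ * b : pointwiseStabilizer W f) :
        EuclideanSpace ℝ (Fin n) ≃ₗᵢ[ℝ] EuclideanSpace ℝ (Fin n)) x = a.1.symm (b.1 x) :=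
      fun x => rfl
    constructor
    · intro h
      have h2 : ∀ x ∈ G, b.1 x = a.1 x := fun x hx => by
        have := h.2 x hx
        rw [hab, LinearIsometryEquiv.symm_apply_eq] at this
        exact this
      exact (Set.image_congr h2).symm
    · intro h
      refine ⟨(a⁻¹ * b).2.1, hstab _ (a⁻¹ * b).2 ?_⟩
      have : ⇑((a⁻¹ * b : pointwiseStabilizer W f) :
        EuclideanSpace ℝ (Fin n) ≃ₗᵢ[ℝ] EuclideanSpace ℝ (Fin n)) = a.1.symm ∘ b.1 := rfl
      rw [this, Set.image_comp, ← h, ← Set.image_comp]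
      simp
  rw [Subgroup.card_eq_card_quotient_mul_card_subgroup
    ((pointwiseStabilizer W G).subgroupOf (pointwiseStabilizer W f)),
    Nat.card_congr (Subgroup.subgroupOfEquivOfLe hle).toEquiv, ← Nat.card_coe_set_eq]
  congr 1
  refine Nat.card_congr (Equiv.ofBijective (Quotient.lift
    (fun a : pointwiseStabilizer W f => (⟨a.1 '' G, (hX _).2 ⟨a.1, a.2, rfl⟩⟩ : X)) ?_) ⟨?_, ?_⟩)
  · intro a b h
    exact Subtype.ext ((hiff a b).1 (QuotientGroup.leftRel_apply.1 h))
  · intro p q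
    induction p using Quotient.inductionOn with | _ a
    induction q using Quotient.inductionOn with | _ b
    intro h
    exact Quotient.sound (QuotientGroup.leftRel_apply.2 ((hiff a b).2 (congrArg Subtype.val h)))
  · rintro ⟨G', hG'⟩
    obtain ⟨u, hu, rfl⟩ := (hX G').1 hG'
    exact ⟨Quotient.mk _ ⟨u, hu⟩, rfl⟩

end FiniteReflection

open FiniteReflection

theorem mainTheorem3 (n d : ℕ) (hd : 1 ≤ d) (hdn : d + 2 ≤ n)
    (W : Subgroup (EuclideanSpace ℝ (Fin n) ≃ₗᵢ[ℝ] EuclideanSpace ℝ (Fin n)))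
    (P : Set (EuclideanSpace ℝ (Fin n))) (hP : IsPlatonicPolytope W P)
    (f F : Set (EuclideanSpace ℝ (Fin n)))
    (hf : IsFaceOfDim P (d - 1) f) (hF : IsFaceOfDim P d F) :
    ({G : Set (EuclideanSpace ℝ (Fin n)) | IsFaceOfDim P d G ∧ f ⊆ G}.ncard : ℚ) =
      (Nat.card (pointwiseStabilizer W f) : ℚ) / (Nat.card (pointwiseStabilizer W F) : ℚ) := by
  have := hP.group.finite
  have hgen := eq_closure_roots hP.group
  obtain ⟨x, rfl⟩ := hP.seed
  set V := {y | ∃ w ∈ W, w x = y} with hVdef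
  have hV : V.Finite := 
    (Set.toFinite (W : Set (EuclideanSpace ℝ (Fin n) ≃ₗᵢ[ℝ] EuclideanSpace ℝ (Fin n)))).image
      (fun w : EuclideanSpace ℝ (Fin n) ≃ₗᵢ[ℝ] EuclideanSpace ℝ (Fin n) => w x)
  have hWV : ∀ w ∈ W, w '' V = V := by
    intro w hw
    apply Set.Subset.antisymm
    · rintro _ ⟨_, ⟨u, hu, rfl⟩, rfl⟩
      exact ⟨w * u, mul_mem hw hu, rfl⟩
    · rintro _ ⟨u, hu, rfl⟩
      exact ⟨w⁻¹ (u x), ⟨w⁻¹ * u, mul_mem (inv_mem hw) hu, rfl⟩, w.apply_symm_apply _⟩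
  have hfin : Module.finrank ℝ (vectorSpan ℝ (convexHull ℝ V)) = n := by
    rw [AffineSubspace.vectorSpan_eq_top_of_affineSpan_eq_top ℝ _ _ hP.full_dim, finrank_top,
      finrank_euclideanSpace_fin]
  have hf' : IsFace (convexHull ℝ V) f := ⟨hf.1, hf.2.1⟩
  obtain ⟨G, hG, hfG, hGdim⟩ := exists_face_succ hV hf' (by
    rintro rfl
    have := hf.2.2
    omega)
  -- Here `1 ≤ d` makes the truncated `d - 1 + 1` equal to `d`.
  have hGd : IsFaceOfDim (convexHull ℝ V) d G := ⟨hG.1, hG.2, by rw [hGdim, hf.2.2]; omega⟩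
  have hcard := card_pointwiseStabilizer_eq_mul (W := W) hfG.1
    (X := {G | IsFaceOfDim (convexHull ℝ V) d G ∧ f ⊆ G}) (by
      intro G'
      constructor
      · rintro ⟨hG', hfG'⟩
        obtain ⟨w, hw, hwG⟩ := hP.one_orbit d (by omega) G G' hGd hG'
        obtain ⟨u, hu, hfix, huG⟩ := exists_fixing_image_eq hgen hV hWV hG ⟨hG'.1, hG'.2.1⟩
          hfG.1 hfG' hw hwG
        exact ⟨u, ⟨hu, hfix⟩, huG⟩
      · rintro ⟨u, ⟨hu, hfix⟩, rfl⟩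
        have h := hG.image (image_convexHull_eq (hWV u hu))
        exact ⟨⟨h.1, h.2, by rw [finrank_vectorSpan_image]; exact hGd.2.2⟩,
          fun y hy => ⟨y, hfG.1 hy, hfix y hy⟩⟩)
    (fun u hu huG => fixes_of_fixes_facet hV hf' hG hfG hGdim.le (hWV u hu.1) hu.2 huG)
  -- `F` need not contain `f`; conjugation by `w` transfers the order of the stabilizer from `G` to
  -- `F`.
  obtain ⟨w, hw, rfl⟩ := hP.one_orbit d (by omega) G F hGd hF
  rw [card_pointwiseStabilizer_image hw, hcard]
  have : Finite (pointwiseStabilizer W G) :=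
    Finite.of_injective (fun u => (⟨u.1, u.2.1⟩ : W)) fun a b h => Subtype.ext (by simpa using h)
  have hpos : (Nat.card (pointwiseStabilizer W G) : ℚ) ≠ 0 := by
    exact_mod_cast Nat.card_pos.ne'
  rw [Nat.cast_mul, mul_div_cancel_right₀ _ hpos]
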